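/- **Conventions.** Let $f\colon\Gamma\to G$ be a group homomorphism. An *$f$-extension* of $G$ with kernel $K$ is a short exact sequence of groups $1\to K\xrightarrow{\iota} E\xrightarrow{n} G\to 1$ together with a homomorphism $\psi\colon\Gamma\to E$ (the structure map) such that $n\circ\psi=f$; it is *central* if $\iota(K)$ lies in the center of $E$. A *map of $f$-extensions* from $(E,\psi)$, with kernel $K$, to $(E',\psi')$, with kernel $K'$, is a pair of homomorphisms $\kappa\colon K\to K'$, $\tau\colon E\to E'$ with $\tau\iota=\iota'\kappa$, $n'\tau=n$ and $\tau\psi=\psi'$. Let $C_*(-)$ be the complex of inhomogeneous (bar) chains with trivial coefficients $\mathbb Z$. Then $H_2(G,\Gamma)$ is the second homology group of the mapping cone of $C_*(f)$, that is, of $C_n(G,\Gamma)=C_n(G)\oplus C_{n-1}(\Gamma)$ with $d(x,y)=(dx-f_*y,\,-dy)$. A central $f$-extension $(E,\psi)$ with kernel an abelian group $A$ determines a homomorphism $H_2(G,\Gamma)\to A$ as follows. Choose a set-theoretic section $\sigma\colon G\to E$ of $n$, and define $c\colon G\times G\to A$ and $b\colon\Gamma\to A$ by $\sigma(g)\sigma(h)=\iota(c(g,h))\,\sigma(gh)$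 and $\psi(\gamma)=\iota(b(\gamma))\,\sigma(f(\gamma))$. Extend $c$ and $b$ linearly to $C_2(G)$ and $C_1(\Gamma)$. The homomorphism is $[(x,y)]\mapsto c(x)+b(y)$; it does not depend on $\sigma$. A *universal central $f$-extension* $(U,\eta)$ of $G$ is a central $f$-extension with kernel $H_2(G,\Gamma)$ whose associated homomorphism $H_2(G,\Gamma)\to H_2(G,\Gamma)$ is the identity. **Theorem.** Assume that the map $f_{ab}\colon\Gamma_{ab}\to G_{ab}$ induced on abelianizations is surjective. Then a universal central $f$-extension of $G$ exists. Moreover, for every universal central $f$-extension $(U,\eta)$ of $G$: 1. for every central $f$-extension $(E,\psi)$ of $G$, with any kernel, there is exactly one map of $f$-extensions from $(U,\eta)$ to $(E,\psi)$; 2. the induced map $\eta_{ab}\colon\Gamma_{ab}\to U_{ab}$ is surjective. -/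

import Mathlib

universe u v w x y

/-! ### Low degrees of the relative chain complex of a group homomorphism

`C_n(G) = ℤ[G^n]` is the complex of inhomogeneous (bar) chains of `G` with trivial integral
coefficients. -/

section RelativeHomology

/-- The bar differential `C₂(G) → C₁(G)`, `[g|h] ↦ [h] - [gh] + [g]`. -/
noncomputable def barD₂ (G : Type*) [Group G] : (G × G →₀ ℤ) →ₗ[ℤ] (G →₀ ℤ) :=
  Finsupp.linearCombination ℤ fun p =>
    Finsupp.single p.2 1 - Finsupp.single (p.1 * p.2) 1 + Finsupp.single p.1 1

/-- The bar differential `C₃(G) → C₂(G)`, `[g|h|k] ↦ [h|k] - [gh|k] + [g|hk] - [g|h]`. -/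
noncomputable def barD₃ (G : Type*) [Group G] : (G × G × G →₀ ℤ) →ₗ[ℤ] (G × G →₀ ℤ) :=
  Finsupp.linearCombination ℤ fun p =>
    Finsupp.single (p.2.1, p.2.2) 1 - Finsupp.single (p.1 * p.2.1, p.2.2) 1
      + Finsupp.single (p.1, p.2.1 * p.2.2) 1 - Finsupp.single (p.1, p.2.1) 1

variable {Γ : Type*} {G : Type*} [Group Γ] [Group G] (f : Γ →* G)

/-- The differential `C₂(G) ⊕ C₁(Γ) → C₁(G) ⊕ C₀(Γ)` of the mapping cone of `C_*(f)`, that is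
`(x, y) ↦ (dx - f y, -dy)`. The second component is left out: it is zero, because the bar
differential `C₁(Γ) → C₀(Γ)` with trivial coefficients is zero. -/
noncomputable def relD₂ : (G × G →₀ ℤ) × (Γ →₀ ℤ) →ₗ[ℤ] (G →₀ ℤ) :=
  barD₂ G ∘ₗ LinearMap.fst ℤ _ _ - Finsupp.lmapDomain ℤ ℤ f ∘ₗ LinearMap.snd ℤ _ _

/-- The differential `C₃(G) ⊕ C₂(Γ) → C₂(G) ⊕ C₁(Γ)` of the mapping cone of `C_*(f)`, that is
`(x, y) ↦ (dx - f y, -dy)`. -/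
noncomputable def relD₃ :
    (G × G × G →₀ ℤ) × (Γ × Γ →₀ ℤ) →ₗ[ℤ] (G × G →₀ ℤ) × (Γ →₀ ℤ) :=
  (barD₃ G ∘ₗ LinearMap.fst ℤ _ _
      - Finsupp.lmapDomain ℤ ℤ (Prod.map f f) ∘ₗ LinearMap.snd ℤ _ _).prod
    (-(barD₂ Γ ∘ₗ LinearMap.snd ℤ _ _))

/-- The second relative integral homology group `H₂(G, Γ)` of `f : Γ → G`: the degree two
homology of the mapping cone of `C_*(f) : C_*(Γ) → C_*(G)`. -/
abbrev RelH₂ : Type _ :=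
  LinearMap.ker (relD₂ f) ⧸ (LinearMap.range (relD₃ f)).submoduleOf (LinearMap.ker (relD₂ f))

theorem relD₂_comp_relD₃ : relD₂ f ∘ₗ relD₃ f = 0 := by
  ext p : 3
  · simp [relD₂, relD₃, barD₂, barD₃, mul_assoc]
    abel
  · have h₁ (γ : Γ) : Finsupp.lmapDomain ℤ ℤ f (.single γ 1) = .single (f γ) 1 := by simp
    have h₂ (q : Γ × Γ) : Finsupp.lmapDomain ℤ ℤ (Prod.map f f) (.single q 1) =
      .single (f q.1, f q.2) 1 := by simp [Prod.map]
    simp [relD₂, relD₃, barD₂, -Finsupp.lmapDomain_apply, h₁, h₂]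

end RelativeHomology

/-! ### Extensions under `Γ` -/

section Extensions

variable {Γ : Type*} {G : Type*} [Group Γ] [Group G]

/-- An `f`-extension of `G` with kernel `K`: an extension `1 → K → E → G → 1` together with a
structure map `Γ → E` whose composition with `E → G` is `f`. -/
structure FExtension (f : Γ →* G) (K E : Type*) [Group K] [Group E]
    extends GroupExtension K E G where
  structureMap : Γ →* E
  rightHom_comp_structureMap : rightHom.comp structureMap = f

/-- A central `f`-extension: the kernel is contained in the center. -/
structure CentralFExtension (f : Γ →* G) (K E : Type*) [Group K] [Group E]
    extends FExtension f K E where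
  central : inl.range ≤ Subgroup.center E

/-- A map of `f`-extensions: a map of extensions that is the identity on `G` and is compatible
with the structure maps. -/
@[ext]
structure FExtension.Hom {f : Γ →* G} {K E K' E' : Type*} [Group K] [Group E] [Group K'] [Group E']
    (S : FExtension f K E) (T : FExtension f K' E') where
  kerMap : K →* K'
  map : E →* E'
  map_comp_inl : map.comp S.inl = T.inl.comp kerMap
  rightHom_comp_map : T.rightHom.comp map = S.rightHom
  map_comp_structureMap : map.comp S.structureMap = T.structureMap

namespace CentralFExtension

variable {f : Γ →* G} {E : Type*} [Group E] {A : Type*} [AddCommGroup A]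
  (S : CentralFExtension f (Multiplicative A) E)

/-- The element of `A` whose image in `E` is `e`; it is only used when `e` maps to `1` in `G`. -/
noncomputable def kerCoord (e : E) : A :=
  (Function.invFun S.inl e).toAdd

theorem inl_kerCoord {e : E} (he : S.rightHom e = 1) :
    S.inl (Multiplicative.ofAdd (S.kerCoord e)) = e := by
  have h : e ∈ S.inl.range := by
    rw [S.range_inl_eq_ker_rightHom]; exact he
  exact Function.invFun_eq h

theorem rightHom_structureMap (γ : Γ) : S.rightHom (S.structureMap γ) = f γ :=
  DFunLike.congr_fun S.rightHom_comp_structureMap γ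

theorem inl_comm (a : Multiplicative A) (e : E) : S.inl a * e = e * S.inl a :=
  ((Subgroup.mem_center_iff.1 (S.central ⟨a, rfl⟩)) e).symm

/-- The factor set `c` of a set-theoretic section `σ`: `σ g * σ h = c (g, h) * σ (g h)`. -/
noncomputable def factorSet (σ : S.Section) (p : G × G) : A :=
  S.kerCoord (σ p.1 * σ p.2 * (σ (p.1 * p.2))⁻¹)

/-- The deviation `b` of the structure map `ψ` from a section `σ`: `ψ γ = b γ * σ (f γ)`. -/
noncomputable def deviation (σ : S.Section) (γ : Γ) : A :=
  S.kerCoord (S.structureMap γ * (σ (f γ))⁻¹)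

theorem factorSet_spec (σ : S.Section) (g h : G) :
    σ g * σ h = S.inl (Multiplicative.ofAdd (S.factorSet σ (g, h))) * σ (g * h) := by
  rw [factorSet, S.inl_kerCoord] <;> simp

theorem deviation_spec (σ : S.Section) (γ : Γ) :
    S.structureMap γ = S.inl (Multiplicative.ofAdd (S.deviation σ γ)) * σ (f γ) := by
  rw [deviation, S.inl_kerCoord] <;> simp [S.rightHom_structureMap]

theorem eq_of_inl_mul {a b : A} {e : E}
    (h : S.inl (Multiplicative.ofAdd a) * e = S.inl (Multiplicative.ofAdd b) * e) : a = b :=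
  Multiplicative.ofAdd.injective (S.inl_injective (mul_right_cancel h))

theorem factorSet_cocycle (σ : S.Section) (g h k : G) :
    S.factorSet σ (h, k) - S.factorSet σ (g * h, k) + S.factorSet σ (g, h * k)
      - S.factorSet σ (g, h) = 0 := by
  have key : S.factorSet σ (g, h) + S.factorSet σ (g * h, k)
      = S.factorSet σ (h, k) + S.factorSet σ (g, h * k) := by
    apply S.eq_of_inl_mul (e := σ (g * h * k))
    rw [ofAdd_add, ofAdd_add, map_mul S.inl, map_mul S.inl, mul_assoc, ← S.factorSet_spec, ← mul_assoc,
      ← S.factorSet_spec, mul_assoc, S.factorSet_spec σ h k, ← mul_assoc, ← S.inl_comm,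
      mul_assoc, S.factorSet_spec σ g (h * k), mul_assoc, mul_assoc]
  rw [← sub_eq_zero] at key
  rw [← neg_eq_zero, ← key]; abel

theorem deviation_mul (σ : S.Section) (γ δ : Γ) :
    S.deviation σ (γ * δ) = S.deviation σ γ + S.deviation σ δ + S.factorSet σ (f γ, f δ) := by
  apply S.eq_of_inl_mul (e := σ (f γ * f δ))
  rw [← map_mul f, ← S.deviation_spec, map_mul, S.deviation_spec σ γ, S.deviation_spec σ δ,
    ofAdd_add, ofAdd_add, map_mul, map_mul, map_mul f, mul_assoc (_ * _) _ (σ _),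
    ← S.factorSet_spec, mul_assoc, ← mul_assoc (σ (f γ)), ← S.inl_comm]
  simp only [mul_assoc]

/-- The relative two-cochain `(x, y) ↦ c x + b y` on `C₂(G, Γ) = C₂(G) ⊕ C₁(Γ)` attached to a
central `f`-extension and a set-theoretic section of it. -/
noncomputable def cochain (σ : S.Section) : (G × G →₀ ℤ) × (Γ →₀ ℤ) →ₗ[ℤ] A :=
  (Finsupp.linearCombination ℤ (S.factorSet σ)).coprod
    (Finsupp.linearCombination ℤ (S.deviation σ))

theorem cochain_comp_relD₃ (σ : S.Section) : S.cochain σ ∘ₗ relD₃ f = 0 := by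
  ext p : 3
  · simpa [cochain, relD₃, barD₃] using S.factorSet_cocycle σ p.1 p.2.1 p.2.2
  · simp [cochain, relD₃, barD₂, Finsupp.mapDomain_single, S.deviation_mul, Prod.map]
    abel

/-- The homomorphism `H₂(G, Γ) → A` given by evaluating the relative two-cocycle of a section. -/
noncomputable def classifyingHomOfSection (σ : S.Section) : RelH₂ f →+ A :=
  (Submodule.liftQ _ (S.cochain σ ∘ₗ (LinearMap.ker (relD₂ f)).subtype) (by
    rintro ⟨z, hz⟩ ⟨t, rfl⟩
    exact LinearMap.congr_fun (S.cochain_comp_relD₃ σ) t)).toAddMonoidHom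

theorem classifyingHomOfSection_eq (σ τ : S.Section) :
    S.classifyingHomOfSection σ = S.classifyingHomOfSection τ := by
  let b : G → A := fun g => S.kerCoord (τ g * (σ g)⁻¹)
  have hb : ∀ g, τ g = S.inl (Multiplicative.ofAdd (b g)) * σ g := by
    intro g
    rw [S.inl_kerCoord] <;> simp
  have hc : ∀ g h, b g + b h + S.factorSet σ (g, h) = S.factorSet τ (g, h) + b (g * h) := by
    intro g h
    apply S.eq_of_inl_mul (e := σ (g * h))
    rw [ofAdd_add, ofAdd_add, ofAdd_add, map_mul S.inl, map_mul S.inl, map_mul S.inl, mul_assoc (_ * _) _ (σ _),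
      ← S.factorSet_spec, mul_assoc (S.inl (Multiplicative.ofAdd (S.factorSet τ _))), ← hb,
      ← S.factorSet_spec, hb g, hb h, mul_assoc, mul_assoc, ← mul_assoc (σ g), ← S.inl_comm]
    simp only [mul_assoc]
  have hd : ∀ γ, S.deviation σ γ = S.deviation τ γ + b (f γ) := by
    intro γ
    apply S.eq_of_inl_mul (e := σ (f γ))
    rw [← S.deviation_spec, ofAdd_add, map_mul, mul_assoc, ← hb, ← S.deviation_spec]
  have key : S.cochain σ + Finsupp.linearCombination ℤ b ∘ₗ relD₂ f = S.cochain τ := by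
    ext p : 3
    · have h1 := hc p.1 p.2
      simp only [cochain, relD₂, barD₂, LinearMap.comp_apply, LinearMap.add_apply,
        LinearMap.inl_apply, LinearMap.coprod_apply, Finsupp.lsingle_apply, LinearMap.sub_apply,
        LinearMap.fst_apply, LinearMap.snd_apply, map_add, map_sub, map_zero,
        Finsupp.linearCombination_single, one_smul, add_zero, sub_zero]
      rw [eq_comm, ← sub_eq_zero] at h1
      rw [eq_comm, ← sub_eq_zero, ← h1]
      abel
    · simp [cochain, relD₂, Finsupp.mapDomain_single, hd]
  ext z
  obtain ⟨⟨z, hz⟩, rfl⟩ := Submodule.Quotient.mk_surjective _ z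
  change S.cochain σ z = S.cochain τ z
  rw [← key, LinearMap.add_apply, LinearMap.comp_apply, LinearMap.mem_ker.1 hz, map_zero, add_zero]

/-- The homomorphism `H₂(G, Γ) → A` that corresponds to a central `f`-extension with kernel `A`:
the class of the extension in `H²(G, Γ; A)`, followed by evaluation on `H₂(G, Γ)`.
It does not depend on the section, by `classifyingHomOfSection_eq`. -/
noncomputable def classifyingHom : RelH₂ f →+ A :=
  S.classifyingHomOfSection ⟨Function.surjInv S.rightHom_surjective,
    Function.surjInv_eq S.rightHom_surjective⟩

end CentralFExtension

/-- `S` is *the universal central `f`-extension*: its kernel is `H₂(G, Γ)`, and it corresponds to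
the identity map of `H₂(G, Γ)`. -/
def IsUniversalCentralFExtension {f : Γ →* G} {U : Type*} [Group U]
    (S : CentralFExtension f (Multiplicative (RelH₂ f)) U) : Prop :=
  S.classifyingHom = AddMonoidHom.id (RelH₂ f)

end Extensions

/-! ### Relative chains in degrees one to three and the splitting of `relD₂`. -/

section RelativeBoundary

variable {Γ : Type*} {G : Type*} [Group Γ] [Group G] {f : Γ →* G}

/-! Surjectivity of `f_ab` says that the cokernel of `relD₂`, which is `H₁(G, Γ)`, vanishes. Since
`C₁(G)` is free, `relD₂` has a linear right inverse `s`, so the cycles are a direct summand of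
`C₂(G, Γ)`. Existence: the class map on cycles extends to a cocycle `θ` on all chains, and the
product of `H₂(G, Γ)` and `G` twisted by `θ` has `θ` as its cochain (`cochain_canonicalSection`).
Maps: two cochains that agree on cycles differ by some `β ∘ relD₂`, and a change of section absorbs
`β`; once the cochains match, a map is written in coordinates (`nonempty_hom_of_classifyingHom`).
Surjectivity of `η_ab`: a homomorphism from `U` to an abelian group that is trivial on `Γ` kills the
kernel, because kernel elements are values of the cochain on cycles (`comp_inl_eq_one`). It then
descends to `G`, where the hypothesis on `f` applies. Uniqueness: two maps differ by a homomorphism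
to a center that is trivial on `Γ`, hence trivial by surjectivity of `η_ab`. -/

theorem relD₂_single_left (g h : G) :
    relD₂ f (.single (g, h) 1, 0) = .single h 1 - .single (g * h) 1 + .single g 1 := by
  simp [relD₂, barD₂]

theorem relD₂_single_right (γ : Γ) : relD₂ f (0, .single γ 1) = -.single (f γ) 1 := by
  simp [relD₂, Finsupp.mapDomain_single]

theorem relD₃_single_left (g h k : G) :
    relD₃ f (.single (g, h, k) 1, 0) =
      (.single (h, k) 1 - .single (g * h, k) 1 + .single (g, h * k) 1 - .single (g, h) 1, 0) := by
  simp [relD₃, barD₃]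

theorem relD₃_single_right (γ δ : Γ) :
    relD₃ f (0, .single (γ, δ) 1) =
      (-.single (f γ, f δ) 1, -(.single δ 1 - .single (γ * δ) 1 + .single γ 1)) := by
  simp [relD₃, barD₂, Finsupp.mapDomain_single, Prod.map]

theorem MonoidHom.eq_one_of_comp_eq_one_of_abelianization_surjective {C : Type*} [CommGroup C]
    (hf : Function.Surjective (Abelianization.map f)) (q : G →* C) (hq : q.comp f = 1) :
    q = 1 := by
  have h : (Abelianization.lift q).comp (Abelianization.map f) = 1 := by
    ext γ
    simpa using DFunLike.congr_fun hq γ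
  ext g
  obtain ⟨x, hx⟩ := hf (Abelianization.of g)
  have := DFunLike.congr_fun h x
  rw [MonoidHom.comp_apply, hx] at this
  simpa using this

/-- If every homomorphism to an abelian group that is trivial on `Γ` is trivial, then `Γ`
surjects onto the abelianization. -/
theorem Abelianization.map_surjective_of_forall
    (h : ∀ q : G →* Abelianization G ⧸ (Abelianization.map f).range, q.comp f = 1 → q = 1) :
    Function.Surjective (Abelianization.map f) := by
  have hq := h ((QuotientGroup.mk' _).comp Abelianization.of) (by
    ext γ
    exact (QuotientGroup.eq_one_iff _).2 ⟨Abelianization.of γ, by simp⟩)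
  intro x
  obtain ⟨g, rfl⟩ := QuotientGroup.mk_surjective x
  exact (QuotientGroup.eq_one_iff _).1 (DFunLike.congr_fun hq g)

/-- In the cokernel, the class of `[g]` is multiplicative in `g` by the boundary of `[g|h]`, and
trivial on `f γ` by that of `(0, [γ])`. The hypothesis makes it trivial on all generators. -/
theorem relD₂_surjective (hf : Function.Surjective (Abelianization.map f)) :
    Function.Surjective (relD₂ f) := by
  let R := LinearMap.range (relD₂ f)
  let q : G →* Multiplicative ((G →₀ ℤ) ⧸ R) := MonoidHom.mk'
    (fun g => Multiplicative.ofAdd (R.mkQ (.single g 1))) (by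
      intro g h
      rw [← ofAdd_add, ← map_add]
      refine congrArg Multiplicative.ofAdd ((Submodule.Quotient.eq' R).2 ?_)
      refine ⟨(.single (g, h) 1, 0), ?_⟩
      rw [relD₂_single_left]
      abel)
  have hq : q = 1 := MonoidHom.eq_one_of_comp_eq_one_of_abelianization_surjective hf q (by
    ext γ
    refine congrArg Multiplicative.ofAdd ((Submodule.Quotient.mk_eq_zero R).2 ?_)
    refine ⟨-(0, .single γ 1), ?_⟩
    rw [map_neg, relD₂_single_right, neg_neg])
  have hR : R.mkQ = 0 := by
    ext g
    exact congrArg Multiplicative.toAdd (DFunLike.congr_fun hq g)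
  intro z
  have : R.mkQ z = 0 := by rw [hR]; rfl
  exact (Submodule.Quotient.mk_eq_zero R).1 this

theorem exists_relD₂_rightInverse (hf : Function.Surjective (Abelianization.map f)) :
    ∃ s : (G →₀ ℤ) →ₗ[ℤ] (G × G →₀ ℤ) × (Γ →₀ ℤ), relD₂ f ∘ₗ s = LinearMap.id :=
  Module.projective_lifting_property _ _ (relD₂_surjective hf)

/-- The class in `H₂(G, Γ)` of a relative cycle. -/
noncomputable def relClass : LinearMap.ker (relD₂ f) →ₗ[ℤ] RelH₂ f := Submodule.mkQ _

theorem relClass_surjective : Function.Surjective (relClass (f := f)) :=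
  Submodule.mkQ_surjective _

theorem exists_cocycle_extending_relClass (hf : Function.Surjective (Abelianization.map f)) :
    ∃ θ : (G × G →₀ ℤ) × (Γ →₀ ℤ) →ₗ[ℤ] RelH₂ f,
      θ ∘ₗ relD₃ f = 0 ∧ ∀ z : LinearMap.ker (relD₂ f), θ z = relClass z := by
  obtain ⟨s, hs⟩ := exists_relD₂_rightInverse hf
  -- The projection onto cycles along the image of `s`.
  let r : (G × G →₀ ℤ) × (Γ →₀ ℤ) →ₗ[ℤ] LinearMap.ker (relD₂ f) :=
    (LinearMap.id - s ∘ₗ relD₂ f).codRestrict _ fun z => by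
      have := LinearMap.congr_fun hs (relD₂ f z)
      simp only [LinearMap.comp_apply, LinearMap.id_apply] at this
      simp [this]
  have hr (z : LinearMap.ker (relD₂ f)) : r z = z := by
    ext1
    simp [r]
  refine ⟨relClass ∘ₗ r, ?_, fun z => by simp [hr]⟩
  refine LinearMap.ext fun t => ?_
  have ht : relD₃ f t ∈ LinearMap.ker (relD₂ f) :=
    LinearMap.congr_fun (relD₂_comp_relD₃ f) t
  change relClass (r ((⟨relD₃ f t, ht⟩ : LinearMap.ker (relD₂ f)) : _ × _)) = 0
  rw [hr]
  exact (Submodule.Quotient.mk_eq_zero _).2 ⟨t, rfl⟩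

end RelativeBoundary

/-! ### The extension built from a relative cocycle. -/

section TwistedProduct

variable {Γ : Type*} {G : Type*} [Group Γ] [Group G] {f : Γ →* G} {A : Type*} [AddCommGroup A]

/-- The product of `A` and `G`, to be given the multiplication twisted by the two-cocycle `θ`
on `C₂(G, Γ)`. -/
@[ext]
structure TwistedProduct (θ : (G × G →₀ ℤ) × (Γ →₀ ℤ) →ₗ[ℤ] A) where
  fst : A
  snd : G

namespace TwistedProduct

variable {θ : (G × G →₀ ℤ) × (Γ →₀ ℤ) →ₗ[ℤ] A}

/-- Vanishing on the boundary of `[g|h|k]`; this gives associativity. -/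
theorem cocycle_left (hθ : θ ∘ₗ relD₃ f = 0) (g h k : G) :
    θ (.single (h, k) 1, 0) + θ (.single (g, h * k) 1, 0) =
      θ (.single (g, h) 1, 0) + θ (.single (g * h, k) 1, 0) := by
  have := LinearMap.congr_fun hθ (.single (g, h, k) 1, 0)
  rw [LinearMap.comp_apply, relD₃_single_left, LinearMap.zero_apply] at this
  rw [← sub_eq_zero, ← this, ← map_add, ← map_add, ← map_sub]
  congr 1
  ext1
  · simp only [Prod.fst_add, Prod.fst_sub]; abel
  · simp

/-- Vanishing on the boundary of `(0, [γ|δ])`; this makes the structure map multiplicative. -/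
theorem cocycle_right (hθ : θ ∘ₗ relD₃ f = 0) (γ δ : Γ) :
    θ (0, .single (γ * δ) 1) =
      θ (0, .single γ 1) + θ (0, .single δ 1) + θ (.single (f γ, f δ) 1, 0) := by
  have := LinearMap.congr_fun hθ (0, .single (γ, δ) 1)
  rw [LinearMap.comp_apply, relD₃_single_right, LinearMap.zero_apply] at this
  rw [← sub_eq_zero, ← this, ← map_add, ← map_add, ← map_sub]
  congr 1
  ext1
  · simp
  · simp only [Prod.snd_add, Prod.snd_sub]; abel

/-- The cocycle need not be normalized: its value at `(1, 1)` shifts the unit, the inverses and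
`inl` below. -/
theorem cocycle_one_left (hθ : θ ∘ₗ relD₃ f = 0) (g : G) :
    θ (.single (1, g) 1, 0) = θ (.single (1, 1) 1, 0) := by
  simpa using cocycle_left hθ 1 1 g

theorem cocycle_one_right (hθ : θ ∘ₗ relD₃ f = 0) (g : G) :
    θ (.single (g, 1) 1, 0) = θ (.single (1, 1) 1, 0) := by
  simpa using (cocycle_left hθ g 1 1).symm

/-- The group structure on the twisted product. -/
@[reducible]
noncomputable def group (hθ : θ ∘ₗ relD₃ f = 0) : Group (TwistedProduct θ) :=
  letI : Mul (TwistedProduct θ) :=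
    ⟨fun x y => ⟨x.fst + y.fst + θ (.single (x.snd, y.snd) 1, 0), x.snd * y.snd⟩⟩
  letI : One (TwistedProduct θ) := ⟨⟨-θ (.single (1, 1) 1, 0), 1⟩⟩
  letI : Inv (TwistedProduct θ) :=
    ⟨fun x => ⟨-x.fst - θ (.single (x.snd⁻¹, x.snd) 1, 0) - θ (.single (1, 1) 1, 0), x.snd⁻¹⟩⟩
  Group.ofLeftAxioms
    (fun x y z => by
      refine TwistedProduct.ext ?_ (mul_assoc x.snd y.snd z.snd)
      change x.fst + y.fst + θ (.single (x.snd, y.snd) 1, 0) + z.fst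
          + θ (.single (x.snd * y.snd, z.snd) 1, 0)
        = x.fst + (y.fst + z.fst + θ (.single (y.snd, z.snd) 1, 0))
          + θ (.single (x.snd, y.snd * z.snd) 1, 0)
      have := cocycle_left hθ x.snd y.snd z.snd
      rw [← sub_eq_zero] at this ⊢
      rw [← neg_eq_zero, ← this]
      abel)
    (fun x => by
      refine TwistedProduct.ext ?_ (one_mul x.snd)
      change -θ (.single (1, 1) 1, 0) + x.fst + θ (.single (1, x.snd) 1, 0) = x.fst
      rw [cocycle_one_left hθ x.snd]
      abel)
    (fun x => by
      refine TwistedProduct.ext ?_ (inv_mul_cancel x.snd)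
      change -x.fst - θ (.single (x.snd⁻¹, x.snd) 1, 0) - θ (.single (1, 1) 1, 0) + x.fst
        + θ (.single (x.snd⁻¹, x.snd) 1, 0) = -θ (.single (1, 1) 1, 0)
      abel)

variable (hθ : θ ∘ₗ relD₃ f = 0)

/-- The central `f`-extension on the twisted product. -/
noncomputable def extension :
    letI := group hθ
    CentralFExtension f (Multiplicative A) (TwistedProduct θ) :=
  letI := group hθ
  have inl_comm (a : Multiplicative A) (x : TwistedProduct θ) :
      x * ⟨a.toAdd - θ (.single (1, 1) 1, 0), 1⟩ = ⟨a.toAdd - θ (.single (1, 1) 1, 0), 1⟩ * x := by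
    refine TwistedProduct.ext ?_ ((mul_one x.snd).trans (one_mul x.snd).symm)
    change x.fst + (a.toAdd - θ (.single (1, 1) 1, 0)) + θ (.single (x.snd, 1) 1, 0) =
      a.toAdd - θ (.single (1, 1) 1, 0) + x.fst + θ (.single (1, x.snd) 1, 0)
    rw [cocycle_one_left hθ x.snd, cocycle_one_right hθ x.snd]
    abel
  { inl := MonoidHom.mk' (fun a => ⟨a.toAdd - θ (.single (1, 1) 1, 0), 1⟩) fun a b => by
      refine TwistedProduct.ext ?_ (one_mul (1 : G)).symm
      change a.toAdd + b.toAdd - θ (.single (1, 1) 1, 0) = a.toAdd - θ (.single (1, 1) 1, 0)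
        + (b.toAdd - θ (.single (1, 1) 1, 0)) + θ (.single (1, 1) 1, 0)
      abel
    rightHom := MonoidHom.mk' TwistedProduct.snd fun _ _ => rfl
    inl_injective := fun a b h => by
      have : a.toAdd - θ (.single (1, 1) 1, 0) = b.toAdd - θ (.single (1, 1) 1, 0) :=
        congrArg TwistedProduct.fst h
      exact Multiplicative.toAdd.injective (sub_left_injective this)
    range_inl_eq_ker_rightHom := by
      ext x
      constructor
      · rintro ⟨a, rfl⟩
        rfl
      · intro hx
        refine ⟨Multiplicative.ofAdd (x.fst + θ (.single (1, 1) 1, 0)), ?_⟩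
        exact TwistedProduct.ext (add_sub_cancel_right _ _) (Eq.symm hx)
    rightHom_surjective := fun g => ⟨⟨0, g⟩, rfl⟩
    structureMap := MonoidHom.mk' (fun γ => ⟨θ (0, .single γ 1), f γ⟩) fun γ δ =>
      TwistedProduct.ext (cocycle_right hθ γ δ) (map_mul f γ δ)
    rightHom_comp_structureMap := rfl
    central := by
      rintro _ ⟨a, rfl⟩
      exact Subgroup.mem_center_iff.2 (inl_comm a) }

theorem extension_inl_mul (a : A) (x : TwistedProduct θ) :
    letI := group hθ
    (extension hθ).inl (Multiplicative.ofAdd a) * x = ⟨a + x.fst, x.snd⟩ := by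
  refine TwistedProduct.ext ?_ (one_mul x.snd)
  change a - θ (.single (1, 1) 1, 0) + x.fst + θ (.single (1, x.snd) 1, 0) = a + x.fst
  rw [cocycle_one_left hθ x.snd]
  abel

/-- The section `g ↦ (0, g)` of the twisted product. -/
noncomputable def canonicalSection :
    letI := group hθ
    (extension hθ).Section :=
  letI := group hθ
  { toFun := fun g => ⟨0, g⟩
    rightInverse_rightHom := fun _ => rfl }

theorem cochain_canonicalSection :
    letI := group hθ
    (extension hθ).cochain (canonicalSection hθ) = θ := by
  let := group hθ
  have hc (g h : G) : (extension hθ).factorSet (canonicalSection hθ) (g, h) =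
      θ (.single (g, h) 1, 0) := by
    apply (extension hθ).eq_of_inl_mul (e := canonicalSection hθ (g * h))
    rw [← (extension hθ).factorSet_spec, extension_inl_mul]
    refine TwistedProduct.ext ?_ rfl
    change (0 : A) + 0 + θ (.single (g, h) 1, 0) = θ (.single (g, h) 1, 0) + 0
    abel
  have hb (γ : Γ) : (extension hθ).deviation (canonicalSection hθ) γ = θ (0, .single γ 1) := by
    apply (extension hθ).eq_of_inl_mul (e := canonicalSection hθ (f γ))
    rw [← (extension hθ).deviation_spec, extension_inl_mul]
    exact TwistedProduct.ext (add_zero _).symm rfl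
  ext p : 3
  · simpa [CentralFExtension.cochain] using hc p.1 p.2
  · simpa [CentralFExtension.cochain] using hb p

end TwistedProduct

end TwistedProduct

/-! ### Maps of central extensions in terms of cochains. -/

namespace CentralFExtension

variable {Γ : Type*} {G : Type*} [Group Γ] [Group G] {f : Γ →* G} {E : Type*} [Group E]
  {A : Type*} [AddCommGroup A] (S : CentralFExtension f (Multiplicative A) E)

theorem classifyingHom_relClass (σ : S.Section) (z : LinearMap.ker (relD₂ f)) :
    S.classifyingHom (relClass z) = S.cochain σ z := by
  rw [classifyingHom, S.classifyingHomOfSection_eq _ σ]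
  rfl

theorem cochain_single_left (σ : S.Section) (g h : G) :
    S.cochain σ (.single (g, h) 1, 0) = S.factorSet σ (g, h) := by
  simp [cochain]

theorem cochain_single_right (σ : S.Section) (γ : Γ) :
    S.cochain σ (0, .single γ 1) = S.deviation σ γ := by
  simp [cochain]

theorem section_one (σ : S.Section) :
    σ 1 = S.inl (Multiplicative.ofAdd (S.factorSet σ (1, 1))) := by
  have := S.factorSet_spec σ 1 1
  rw [mul_one] at this
  exact mul_right_cancel this

/-- The coordinate in the kernel of an element of the extension, relative to a section. -/
noncomputable def sectionCoord (σ : S.Section) (e : E) : A :=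
  S.kerCoord (e * (σ (S.rightHom e))⁻¹)

theorem sectionCoord_spec (σ : S.Section) (e : E) :
    e = S.inl (Multiplicative.ofAdd (S.sectionCoord σ e)) * σ (S.rightHom e) := by
  rw [sectionCoord, S.inl_kerCoord] <;> simp

/-- In the coordinates `(sectionCoord, rightHom)` the group `E` is the product twisted by the factor
set. -/
theorem sectionCoord_mul (σ : S.Section) (e e' : E) :
    S.sectionCoord σ (e * e') = S.sectionCoord σ e + S.sectionCoord σ e' +
      S.factorSet σ (S.rightHom e, S.rightHom e') := by
  apply S.eq_of_inl_mul (e := σ (S.rightHom e * S.rightHom e'))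
  rw [← map_mul S.rightHom, ← S.sectionCoord_spec, map_mul S.rightHom, ofAdd_add, ofAdd_add,
    map_mul S.inl, map_mul S.inl, mul_assoc (_ * _) _ (σ _), ← S.factorSet_spec, mul_assoc,
    ← mul_assoc (S.inl _) (σ _) (σ _), S.inl_comm (Multiplicative.ofAdd (S.sectionCoord σ e')),
    mul_assoc (σ _), ← S.sectionCoord_spec σ e', ← mul_assoc, ← S.sectionCoord_spec σ e]

theorem sectionCoord_structureMap (σ : S.Section) (γ : Γ) :
    S.sectionCoord σ (S.structureMap γ) = S.deviation σ γ := by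
  rw [sectionCoord, S.rightHom_structureMap, deviation]

theorem sectionCoord_inl (σ : S.Section) (a : A) :
    S.sectionCoord σ (S.inl (Multiplicative.ofAdd a)) = a - S.factorSet σ (1, 1) := by
  apply S.eq_of_inl_mul (e := σ 1)
  have h : S.rightHom (S.inl (Multiplicative.ofAdd a)) = 1 := S.rightHom_inl _
  conv_lhs => rw [← h, ← S.sectionCoord_spec]
  rw [S.section_one, ← map_mul, ← ofAdd_add, sub_add_cancel]

/-- The map of extensions given by a homomorphism of kernels that carries the relative cocycle of
one section to that of another. -/
noncomputable def homOfCochain {E' : Type*} [Group E'] {B : Type*} [AddCommGroup B]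
    (T : CentralFExtension f (Multiplicative B) E') (σ : S.Section) (τ : T.Section) (κ : A →+ B)
    (h : T.cochain τ = κ.toIntLinearMap ∘ₗ S.cochain σ) :
    FExtension.Hom S.toFExtension T.toFExtension :=
  have hc (g k : G) : T.factorSet τ (g, k) = κ (S.factorSet σ (g, k)) := by
    simpa [cochain_single_left] using LinearMap.congr_fun h (.single (g, k) 1, 0)
  have hd (γ : Γ) : T.deviation τ γ = κ (S.deviation σ γ) := by
    simpa [cochain_single_right] using LinearMap.congr_fun h (0, .single γ 1)
  { kerMap := AddMonoidHom.toMultiplicative κ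
    -- In coordinates this is `(a, g) ↦ (κ a, g)`.
    map := MonoidHom.mk' (fun e => T.inl (Multiplicative.ofAdd (κ (S.sectionCoord σ e))) *
      τ (S.rightHom e)) fun e e' => by
        rw [S.sectionCoord_mul, map_add κ, map_add κ, ← hc, ofAdd_add, ofAdd_add, map_mul T.inl,
          map_mul T.inl, map_mul S.rightHom, mul_assoc (_ * _) _ (τ _), ← T.factorSet_spec,
          mul_assoc, ← mul_assoc (T.inl _) (τ _) (τ _), T.inl_comm _ (τ _)]
        simp only [mul_assoc]
    map_comp_inl := by
      refine MonoidHom.ext fun a => ?_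
      change T.inl (Multiplicative.ofAdd (κ (S.sectionCoord σ (S.inl a)))) *
        τ (S.rightHom (S.inl a)) = T.inl (Multiplicative.ofAdd (κ a.toAdd))
      rw [S.rightHom_inl, T.section_one, ← map_mul, ← ofAdd_add, hc, ← map_add κ,
        ← ofAdd_toAdd a, S.sectionCoord_inl, sub_add_cancel]
      rfl
    rightHom_comp_map := by
      ext e
      simp
    map_comp_structureMap := by
      ext γ
      change T.inl (Multiplicative.ofAdd (κ (S.sectionCoord σ (S.structureMap γ)))) *
        τ (S.rightHom (S.structureMap γ)) = T.structureMap γ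
      rw [S.sectionCoord_structureMap, S.rightHom_structureMap, ← hd, ← T.deviation_spec] }

/-- A section translated by a function to the kernel. -/
noncomputable def translateSection (σ : S.Section) (β : G → A) : S.Section where
  toFun g := S.inl (Multiplicative.ofAdd (β g)) * σ g
  rightInverse_rightHom g := by simp

/-- Every coboundary can thus be added to the cochain by a change of section. -/
theorem cochain_translateSection (σ : S.Section) (β : G → A) :
    S.cochain (S.translateSection σ β) =
      S.cochain σ + Finsupp.linearCombination ℤ β ∘ₗ relD₂ f := by
  have hσ (g : G) : S.translateSection σ β g = S.inl (Multiplicative.ofAdd (β g)) * σ g := rfl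
  ext p : 3
  · obtain ⟨g, h⟩ := p
    have key : S.factorSet (S.translateSection σ β) (g, h) + β (g * h) =
        β g + β h + S.factorSet σ (g, h) := by
      apply S.eq_of_inl_mul (e := σ (g * h))
      rw [ofAdd_add, ofAdd_add, ofAdd_add, map_mul S.inl, map_mul S.inl, map_mul S.inl,
        mul_assoc (_ * _) _ (σ _), ← S.factorSet_spec, mul_assoc, ← hσ, ← S.factorSet_spec, hσ, hσ,
        mul_assoc, ← mul_assoc (σ _) (S.inl _) (σ _), ← S.inl_comm]
      simp only [mul_assoc]
    change S.cochain _ (.single (g, h) 1, 0) = S.cochain σ (.single (g, h) 1, 0) +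
      Finsupp.linearCombination ℤ β (relD₂ f (.single (g, h) 1, 0))
    rw [cochain_single_left, cochain_single_left, relD₂_single_left, eq_sub_of_add_eq key]
    simp only [map_add, map_sub, Finsupp.linearCombination_single, one_smul]
    abel
  · change S.cochain _ (0, .single p 1) = S.cochain σ (0, .single p 1) +
      Finsupp.linearCombination ℤ β (relD₂ f (0, .single p 1))
    rw [cochain_single_right, cochain_single_right, relD₂_single_right]
    have key : S.deviation (S.translateSection σ β) p + β (f p) = S.deviation σ p := by
      apply S.eq_of_inl_mul (e := σ (f p))
      rw [ofAdd_add, map_mul, mul_assoc, ← hσ, ← S.deviation_spec, ← S.deviation_spec]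
    rw [← key]
    simp

/-- A homomorphism of kernels that is compatible with the classifying homomorphisms comes from a
map of extensions. -/
theorem nonempty_hom_of_classifyingHom (hf : Function.Surjective (Abelianization.map f))
    {E' : Type*} [Group E'] {B : Type*} [AddCommGroup B]
    (T : CentralFExtension f (Multiplicative B) E') (κ : A →+ B)
    (h : T.classifyingHom = κ.comp S.classifyingHom) :
    Nonempty (FExtension.Hom S.toFExtension T.toFExtension) := by
  obtain ⟨s, hs⟩ := exists_relD₂_rightInverse hf
  let σ : S.Section := ⟨Function.surjInv S.rightHom_surjective,
    Function.surjInv_eq S.rightHom_surjective⟩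
  let τ : T.Section := ⟨Function.surjInv T.rightHom_surjective,
    Function.surjInv_eq T.rightHom_surjective⟩
  let Δ := κ.toIntLinearMap ∘ₗ S.cochain σ - T.cochain τ
  -- `Δ` vanishes on cycles by `h`, so it factors through `relD₂` as `Δ ∘ s`; the values of `Δ ∘ s`
  -- on generators give the translation of `τ`.
  have hΔ (z) : Δ (s (relD₂ f z)) = Δ z := by
    rw [eq_comm, ← sub_eq_zero, ← map_sub]
    have hz : z - s (relD₂ f z) ∈ LinearMap.ker (relD₂ f) := by
      have := LinearMap.congr_fun hs (relD₂ f z)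
      simp only [LinearMap.comp_apply, LinearMap.id_apply] at this
      simp [this]
    have := DFunLike.congr_fun h (relClass ⟨_, hz⟩)
    rw [T.classifyingHom_relClass τ, AddMonoidHom.comp_apply, S.classifyingHom_relClass σ] at this
    exact sub_eq_zero.2 this.symm
  have hβ : Finsupp.linearCombination ℤ (fun g => Δ (s (.single g 1))) = Δ ∘ₗ s := by
    ext g
    simp
  refine ⟨S.homOfCochain T σ (T.translateSection τ fun g => Δ (s (.single g 1))) κ ?_⟩
  rw [cochain_translateSection, hβ]
  refine LinearMap.ext fun z => ?_
  change T.cochain τ z + Δ (s (relD₂ f z)) = κ (S.cochain σ z)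
  rw [hΔ]
  exact add_sub_cancel _ _

/-- If the classifying homomorphism is surjective, then a homomorphism to an abelian group that is
trivial on `Γ` is trivial on the kernel. -/
theorem comp_inl_eq_one (hS : Function.Surjective S.classifyingHom) {C : Type*} [CommGroup C]
    (q : E →* C) (hq : q.comp S.structureMap = 1) : q.comp S.inl = 1 := by
  let σ : S.Section := ⟨Function.surjInv S.rightHom_surjective,
    Function.surjInv_eq S.rightHom_surjective⟩
  let q' : A →+ Additive C := MonoidHom.toAdditiveRight (q.comp S.inl)
  have hq' (a : A) : q' a = Additive.ofMul (q (S.inl (Multiplicative.ofAdd a))) := rfl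
  -- Applying `q` to the equations defining `factorSet` and `deviation` exhibits the pushed cochain
  -- as a coboundary; triviality on `Γ` is used for the second component.
  have key : q'.toIntLinearMap ∘ₗ S.cochain σ =
      Finsupp.linearCombination ℤ (fun g => Additive.ofMul (q (σ g))) ∘ₗ relD₂ f := by
    ext p : 3
    · obtain ⟨g, h⟩ := p
      change q' (S.cochain σ (.single (g, h) 1, 0)) =
        Finsupp.linearCombination ℤ _ (relD₂ f (.single (g, h) 1, 0))
      rw [cochain_single_left, relD₂_single_left]
      simp only [map_add, map_sub, Finsupp.linearCombination_single, one_smul]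
      have := congrArg (fun e => Additive.ofMul (q e)) (S.factorSet_spec σ g h)
      simp only [map_mul, ofMul_mul, ← hq'] at this
      rw [← sub_eq_of_eq_add this]
      abel
    · change q' (S.cochain σ (0, .single p 1)) =
        Finsupp.linearCombination ℤ _ (relD₂ f (0, .single p 1))
      rw [cochain_single_right, relD₂_single_right]
      simp only [map_neg, Finsupp.linearCombination_single, one_smul]
      have := congrArg (fun e => Additive.ofMul (q e)) (S.deviation_spec σ p)
      have hp : q (S.structureMap p) = 1 := DFunLike.congr_fun hq p
      simp only [map_mul, ofMul_mul, ← hq', hp, ofMul_one] at this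
      exact eq_neg_of_add_eq_zero_left this.symm
  refine MonoidHom.ext fun a => ?_
  obtain ⟨x, hx⟩ := hS a.toAdd
  obtain ⟨z, rfl⟩ := relClass_surjective x
  rw [S.classifyingHom_relClass σ] at hx
  have := LinearMap.congr_fun key z
  rw [LinearMap.comp_apply, LinearMap.comp_apply, LinearMap.mem_ker.1 z.2, map_zero, hx] at this
  exact congrArg Additive.toMul this

theorem eq_one_of_comp_structureMap_eq_one (hf : Function.Surjective (Abelianization.map f))
    (hS : Function.Surjective S.classifyingHom) {C : Type*} [CommGroup C]
    (q : E →* C) (hq : q.comp S.structureMap = 1) : q = 1 := by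
  have hi := S.comp_inl_eq_one hS q hq
  have hker : S.rightHom.ker ≤ q.ker := by
    rw [← S.range_inl_eq_ker_rightHom]
    rintro _ ⟨a, rfl⟩
    exact DFunLike.congr_fun hi a
  let r : G →* C := S.rightHom.liftOfSurjective S.rightHom_surjective ⟨q, hker⟩
  have hr (e : E) : r (S.rightHom e) = q e :=
    S.rightHom.liftOfRightInverse_comp_apply _ _ ⟨q, hker⟩ e
  have hr1 : r = 1 := MonoidHom.eq_one_of_comp_eq_one_of_abelianization_surjective hf r (by
    ext γ
    rw [MonoidHom.comp_apply, ← S.rightHom_structureMap, hr]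
    exact DFunLike.congr_fun hq γ)
  ext e
  rw [← hr, hr1]
  rfl

end CentralFExtension

/-! ### Uniqueness of maps into a central extension. -/

section Uniqueness

variable {Γ : Type*} {G : Type*} [Group Γ] [Group G] {f : Γ →* G}

/-- A map of `f`-extensions to a central one is unique, if the structure map of the source is
surjective on abelianizations. -/
theorem FExtension.Hom.eq_of_abelianization_surjective {K E K' E' : Type*} [Group K] [Group E]
    [Group K'] [Group E'] {S : FExtension f K E} {T : CentralFExtension f K' E'}
    (hS : Function.Surjective (Abelianization.map S.structureMap))
    (φ φ' : FExtension.Hom S T.toFExtension) : φ = φ' := by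
  have hφ (e : E) : T.rightHom (φ.map e) = S.rightHom e := DFunLike.congr_fun φ.rightHom_comp_map e
  have hφ' (e : E) : T.rightHom (φ'.map e) = S.rightHom e :=
    DFunLike.congr_fun φ'.rightHom_comp_map e
  have hmem (e : E) : φ.map e * (φ'.map e)⁻¹ ∈ Subgroup.center E' := by
    apply T.central
    rw [T.range_inl_eq_ker_rightHom, MonoidHom.mem_ker]
    simp [hφ, hφ']
  -- The pointwise quotient of the two maps is multiplicative because its values are central.
  let d : E →* Subgroup.center E' := MonoidHom.mk' (fun e => ⟨_, hmem e⟩) fun e e' => by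
    ext1
    have := Subgroup.mem_center_iff.1 (hmem e')
    simp only [map_mul, mul_inv_rev, Subgroup.coe_mul]
    calc _ = φ.map e * (φ.map e' * (φ'.map e')⁻¹) * (φ'.map e)⁻¹ := by simp only [mul_assoc]
      _ = _ := by rw [mul_assoc, ← this, mul_assoc]
  have hdΓ : d.comp S.structureMap = 1 := by
    refine MonoidHom.ext fun γ => Subtype.ext ?_
    have h1 := DFunLike.congr_fun φ.map_comp_structureMap γ
    have h2 := DFunLike.congr_fun φ'.map_comp_structureMap γ
    simp only [MonoidHom.comp_apply] at h1 h2
    change φ.map (S.structureMap γ) * (φ'.map (S.structureMap γ))⁻¹ = 1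
    rw [h1, h2, mul_inv_cancel]
  let _ : CommGroup (Subgroup.center E') :=
    { (inferInstance : Group (Subgroup.center E')) with
      mul_comm := fun x y => Subtype.ext (Subgroup.mem_center_iff.1 y.2 x) }
  have hd : d = 1 := MonoidHom.eq_one_of_comp_eq_one_of_abelianization_surjective hS d hdΓ
  have hmap : φ.map = φ'.map := by
    ext e
    exact mul_inv_eq_one.1 (congrArg Subtype.val (DFunLike.congr_fun hd e))
  ext1
  · ext a
    apply T.inl_injective
    have h1 := DFunLike.congr_fun φ.map_comp_inl a
    have h2 := DFunLike.congr_fun φ'.map_comp_inl a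
    simp only [MonoidHom.comp_apply] at h1 h2
    rw [← h1, ← h2, hmap]
  · exact hmap

/-- Lets an arbitrary kernel be treated as an abelian one, so that `classifyingHom` is available. -/
theorem CentralFExtension.ker_mul_comm {K E : Type*} [Group K] [Group E]
    (T : CentralFExtension f K E) (a b : K) : a * b = b * a := by
  apply T.inl_injective
  rw [map_mul, map_mul]
  exact (Subgroup.mem_center_iff.1 (T.central ⟨b, rfl⟩)) _

end Uniqueness

/-! ### The universal property. -/

theorem IsUniversalCentralFExtension.nonempty_hom {Γ G U : Type*} [Group Γ] [Group G] [Group U]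
    {f : Γ →* G} (hf : Function.Surjective (Abelianization.map f))
    {S : CentralFExtension f (Multiplicative (RelH₂ f)) U} (hS : IsUniversalCentralFExtension S)
    {K E : Type*} [Group K] [Group E] (T : CentralFExtension f K E) :
    Nonempty (FExtension.Hom S.toFExtension T.toFExtension) := by
  let : AddCommGroup (Additive K) :=
    { (inferInstance : AddGroup (Additive K)) with
      add_comm := fun a b => T.ker_mul_comm a b }
  let T' : CentralFExtension f (Multiplicative (Additive K)) E := T
  -- As `S` classifies the identity, the classifying homomorphism of the target itself serves as the
  -- map of kernels.
  exact S.nonempty_hom_of_classifyingHom hf T' T'.classifyingHom (by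
    rw [hS, AddMonoidHom.comp_id])

theorem theorem2p12 {Γ : Type u} {G : Type v} [Group Γ] [Group G] (f : Γ →* G)
    (hf : Function.Surjective (Abelianization.map f)) :
    (∃ (U : Type (max u v)) (_ : Group U)
        (S : CentralFExtension f (Multiplicative (RelH₂ f)) U), IsUniversalCentralFExtension S) ∧
    ∀ (U : Type w) [Group U] (S : CentralFExtension f (Multiplicative (RelH₂ f)) U),
      IsUniversalCentralFExtension S →
        (∀ (K : Type x) (E : Type y) [Group K] [Group E] (T : CentralFExtension f K E),
          ∃ φ : FExtension.Hom S.toFExtension T.toFExtension,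
            ∀ φ' : FExtension.Hom S.toFExtension T.toFExtension, φ' = φ) ∧
        Function.Surjective (Abelianization.map S.structureMap) := by
  constructor
  · obtain ⟨θ, hθ, hθ'⟩ := exists_cocycle_extending_relClass hf
    let := TwistedProduct.group hθ
    refine ⟨TwistedProduct θ, TwistedProduct.group hθ, TwistedProduct.extension hθ, ?_⟩
    refine AddMonoidHom.ext fun a => ?_
    obtain ⟨z, rfl⟩ := relClass_surjective a
    rw [CentralFExtension.classifyingHom_relClass _ (TwistedProduct.canonicalSection hθ),
      TwistedProduct.cochain_canonicalSection, hθ', AddMonoidHom.id_apply]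
  · intro U _ S hS
    have hsurj : Function.Surjective S.classifyingHom := by
      rw [hS]
      exact Function.surjective_id
    have hη : Function.Surjective (Abelianization.map S.structureMap) :=
      Abelianization.map_surjective_of_forall
        (S.eq_one_of_comp_structureMap_eq_one hf hsurj)
    refine ⟨fun K E _ _ T => ?_, hη⟩
    obtain ⟨φ⟩ := hS.nonempty_hom hf T
    exact ⟨φ, fun φ' => FExtension.Hom.eq_of_abelianization_surjective hη φ' φ⟩
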